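/- Let $\mathcal D$ be a Grothendieck category (an abelian category with exact direct limits and a generator). For a class $\mathcal X$ of objects put $\mathcal X^{\perp}=\{Y \mid \operatorname{Ext}^1(X,Y)=0\ \text{for all } X\in\mathcal X\}$ and ${}^{\perp}\mathcal X=\{Y \mid \operatorname{Ext}^1(Y,X)=0\ \text{for all } X\in\mathcal X\}$. Let $(\mathcal B,\mathcal C)$ be a cotorsion pair in $\mathcal D$, i.e. a pair of classes of objects with $\mathcal B={}^{\perp}\mathcal C$ and $\mathcal C=\mathcal B^{\perp}$. The pair is *cogenerated by a set* if there is a set $\mathcal S$ of objects with $(\mathcal B,\mathcal C)=({}^{\perp}(\mathcal S^{\perp}),\mathcal S^{\perp})$. It is *complete* if for every object $A$ there are short exact sequences $0\to A\to C_1\to B_1\to 0$ and $0\to C_2\to B_2\to A\to 0$ with $B_1,B_2\in\mathcal B$ and $C_1,C_2\in\mathcal C$. It is *closed* if $\mathcal B$ is closed under direct limits (colimits of direct systems indexed by directed sets). A *$\mathcal C$-envelope* of an object $M$ is a morphism $u:M\to X$ with $X\in\mathcal C$ such that every morphism $M\to Y$ with $Y\in\mathcal C$ factors through $u$, and every endomorphism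 $f:X\to X$ with $fu=u$ is an isomorphism. 1. If $\mathcal D$ has a projective generator and $(\mathcal B,\mathcal C)$ is cogenerated by a set, then $(\mathcal B,\mathcal C)$ is complete. 2. If $(\mathcal B,\mathcal C)$ is complete and closed, then every object of $\mathcal D$ has a $\mathcal C$-envelope. -/

import Mathlib

open CategoryTheory CategoryTheory.Limits

universe v u

namespace CotorsionPairs

section Abelian

variable {D : Type u} [Category.{v} D] [Abelian D] [HasExt.{v} D]

/-- The right perpendicular class: the objects `Y` with `Ext¹(X, Y) = 0` for all `X` in the
class. -/
def rightPerp (P : ObjectProperty D) : ObjectProperty D :=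
  fun Y => ∀ X : D, P X → Subsingleton (Abelian.Ext.{v} X Y 1)

/-- The left perpendicular class: the objects `X` with `Ext¹(X, Y) = 0` for all `Y` in the
class. -/
def leftPerp (P : ObjectProperty D) : ObjectProperty D :=
  fun X => ∀ Y : D, P Y → Subsingleton (Abelian.Ext.{v} X Y 1)

/-- `(B, C)` is a cotorsion pair. -/
structure IsCotorsionPair (B C : ObjectProperty D) : Prop where
  left_eq : B = leftPerp C
  right_eq : C = rightPerp B

/-- `(B, C)` coincides with the pair `(⊥(S⊥), S⊥)` for some (small) set `S` of objects. -/
def IsCogeneratedBySet (B C : ObjectProperty D) : Prop :=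
  ∃ S : ObjectProperty D, ObjectProperty.Small.{v} S ∧
    B = leftPerp (rightPerp S) ∧ C = rightPerp S

end Abelian

section Approximations

variable {D : Type u} [Category.{v} D]

/-- Every object `A` admits short exact sequences `0 ⟶ A ⟶ C₁ ⟶ B₁ ⟶ 0` and
`0 ⟶ C₂ ⟶ B₂ ⟶ A ⟶ 0` with `B₁, B₂` in `B` and `C₁, C₂` in `C`. -/
def IsComplete [Abelian D] (B C : ObjectProperty D) : Prop :=
  ∀ A : D,
    (∃ (C₁ B₁ : D) (i : A ⟶ C₁) (p : C₁ ⟶ B₁) (w : i ≫ p = 0),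
      C C₁ ∧ B B₁ ∧ (ShortComplex.mk i p w).ShortExact) ∧
    (∃ (C₂ B₂ : D) (i : C₂ ⟶ B₂) (p : B₂ ⟶ A) (w : i ≫ p = 0),
      C C₂ ∧ B B₂ ∧ (ShortComplex.mk i p w).ShortExact)

/-- The class is closed under direct limits, i.e. under colimits of direct systems indexed by
(small, nonempty) directed partially ordered sets. -/
def ClosedUnderDirectLimits (B : ObjectProperty D) : Prop :=
  ∀ (J : Type v) [PartialOrder J] [IsDirectedOrder J] [Nonempty J],
    B.IsClosedUnderColimitsOfShape J

/-- `u : M ⟶ X` is a `P`-preenvelope. -/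
structure IsPreenvelope (P : ObjectProperty D) {M X : D} (u : M ⟶ X) : Prop where
  mem : P X
  factors : ∀ (Y : D) (f : M ⟶ Y), P Y → ∃ g : X ⟶ Y, u ≫ g = f

/-- `u : M ⟶ X` is a `P`-envelope: a preenvelope which is a minimal morphism. -/
structure IsEnvelope (P : ObjectProperty D) {M X : D} (u : M ⟶ X) : Prop
    extends IsPreenvelope P u where
  minimal : ∀ f : X ⟶ X, u ≫ f = u → IsIso f

end Approximations

end CotorsionPairs

/-! Part 1 is the small object argument for the inclusions `kernel (Projective.π X) ⟶
Projective.over X` with `X` in `S`. Lifting against them encodes `Ext¹(X, -) = 0`, so the resulting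
factorizations of `A ⟶ 0` and of a projective presentation of `A` give the two approximation
sequences (`exists_factorization_of_small`).

For part 2, consider the monomorphisms out of `M` with cokernel in `B`, as objects under `M`. They
form a category with directed colimits, and completeness supplies a weakly terminal object.
Stabilizing kernels replaces it by one all of whose outgoing morphisms are monic
(`exists_forall_mono`); its endomorphisms are then invertible, since otherwise it would have too
many subobjects (`isIso_of_forall_mono`). It lies in `C`, being a retract of an object of `C`. -/

namespace CotorsionPairs

open scoped ZeroObject

/-! ### Vanishing of `Ext¹` as extension and lifting problems -/

section Ext

variable {D : Type u} [Category.{v} D] [Abelian D] [HasExt.{v} D]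

lemma exists_extension_of_subsingleton_ext {S : ShortComplex D} (hS : S.ShortExact) {Y : D}
    [Subsingleton (Abelian.Ext.{v} S.X₃ Y 1)] (f : S.X₁ ⟶ Y) : ∃ g : S.X₂ ⟶ Y, S.f ≫ g = f := by
  obtain ⟨x, hx⟩ := Abelian.Ext.contravariant_sequence_exact₁ hS Y (Abelian.Ext.mk₀ f)
    (add_zero 1) (Subsingleton.elim _ _)
  obtain ⟨g, rfl⟩ := Abelian.Ext.addEquiv₀.symm.surjective x
  refine ⟨g, Abelian.Ext.addEquiv₀.symm.injective ?_⟩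
  simpa using hx

lemma subsingleton_ext_of_forall_extension {S : ShortComplex D} (hS : S.ShortExact) {Y : D}
    [Projective S.X₂] (h : ∀ f : S.X₁ ⟶ Y, ∃ g : S.X₂ ⟶ Y, S.f ≫ g = f) :
    Subsingleton (Abelian.Ext.{v} S.X₃ Y 1) := by
  refine subsingleton_of_forall_eq 0 fun e => ?_
  obtain ⟨x, rfl⟩ := Abelian.Ext.contravariant_sequence_exact₃ hS Y e
    (Abelian.Ext.eq_zero_of_projective _) (add_zero 1)
  obtain ⟨f, rfl⟩ := Abelian.Ext.addEquiv₀.symm.surjective x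
  obtain ⟨g, rfl⟩ := h f
  simp [← Abelian.Ext.mk₀_comp_mk₀]

lemma subsingleton_ext_of_forall_lift {S : ShortComplex D} (hS : S.ShortExact) {X : D}
    [Injective S.X₂] (h : ∀ f : X ⟶ S.X₃, ∃ g : X ⟶ S.X₂, g ≫ S.g = f) :
    Subsingleton (Abelian.Ext.{v} X S.X₁ 1) := by
  refine subsingleton_of_forall_eq 0 fun e => ?_
  obtain ⟨x, rfl⟩ := Abelian.Ext.covariant_sequence_exact₁ X hS e
    (Abelian.Ext.eq_zero_of_injective _) (zero_add 1)
  obtain ⟨f, rfl⟩ := Abelian.Ext.addEquiv₀.symm.surjective x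
  obtain ⟨g, rfl⟩ := h f
  simp [← Abelian.Ext.mk₀_comp_mk₀]

/-- The left perpendicular class of any class is closed under extensions. -/
lemma leftPerp_of_shortExact {P : ObjectProperty D} {S : ShortComplex D} (hS : S.ShortExact)
    (h₁ : leftPerp P S.X₁) (h₃ : leftPerp P S.X₃) : leftPerp P S.X₂ := by
  intro Y hY
  have := h₁ Y hY
  have := h₃ Y hY
  refine subsingleton_of_forall_eq 0 fun e => ?_
  obtain ⟨x, rfl⟩ := Abelian.Ext.contravariant_sequence_exact₂ hS Y e (Subsingleton.elim _ _)
  rw [Subsingleton.elim x 0, Abelian.Ext.comp_zero]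

/-- The right perpendicular class of any class is closed under retracts. -/
lemma rightPerp_of_retract {P : ObjectProperty D} {Y Z : D} (r : Retract Y Z)
    (h : rightPerp P Z) : rightPerp P Y := by
  intro X hX
  have := h X hX
  refine subsingleton_of_forall_eq 0 fun e => ?_
  have : (e.comp (Abelian.Ext.mk₀ r.i) (add_zero 1)).comp
      (Abelian.Ext.mk₀ r.r) (add_zero 1) = e := by simp
  rw [← this, Subsingleton.elim (e.comp (Abelian.Ext.mk₀ r.i) (add_zero 1)) 0,
    Abelian.Ext.zero_comp]

lemma leftPerp_of_projective (P : ObjectProperty D) (X : D) [Projective X] : leftPerp P X :=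
  fun _ _ => subsingleton_of_forall_eq 0 Abelian.Ext.eq_zero_of_projective

/-- Projectivity lifts the bottom map; its failure to restrict to the top map lands in the kernel
`S'.X₁`, and the vanishing of `Ext¹` extends this error to a correction. -/
lemma hasLiftingProperty_of_subsingleton_ext {S S' : ShortComplex D} (hS : S.ShortExact)
    (hS' : S'.ShortExact) [Projective S.X₂] [Subsingleton (Abelian.Ext.{v} S.X₃ S'.X₁ 1)] :
    HasLiftingProperty S.f S'.g where
  sq_hasLift {a b} sq := by
    have := hS'.epi_g
    have := hS'.mono_f
    let l := Projective.factorThru b S'.g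
    obtain ⟨k, hk⟩ := exists_extension_of_subsingleton_ext hS
      (hS'.exact.lift (a - S.f ≫ l) (by simp [l, sq.w]))
    refine ⟨⟨⟨l + k ≫ S'.f, ?_, ?_⟩⟩⟩
    · rw [Preadditive.comp_add, reassoc_of% hk]
      simp
    · simp [l]

lemma subsingleton_ext_of_hasLiftingProperty {S S' : ShortComplex D} (hS : S.ShortExact)
    [Projective S.X₂] (hS' : S'.Exact) [Mono S'.f] [HasLiftingProperty S.f S'.g] :
    Subsingleton (Abelian.Ext.{v} S.X₃ S'.X₁ 1) := by
  refine subsingleton_ext_of_forall_extension hS fun f => ?_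
  have sq : CommSq (f ≫ S'.f) S.f S'.g 0 := ⟨by simp⟩
  refine ⟨hS'.lift sq.lift (by simp), ?_⟩
  simp [← cancel_mono S'.f]

lemma leftPerp_of_forall_hasLiftingProperty [EnoughInjectives D] {P : ObjectProperty D}
    {S : ShortComplex D} (hS : S.ShortExact)
    (h : ∀ S' : ShortComplex D, S'.ShortExact → P S'.X₁ → HasLiftingProperty S.f S'.g) :
    leftPerp P S.X₃ := by
  intro Y hY
  let S' := ShortComplex.mk (Injective.ι Y) (cokernel.π (Injective.ι Y)) (by simp)
  have hS' : S'.ShortExact := { exact := ShortComplex.exact_cokernel _ }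
  have : Injective S'.X₂ := inferInstanceAs (Injective (Injective.under Y))
  have := hS.epi_g
  have := h S' hS' hY
  refine subsingleton_ext_of_forall_lift hS' fun f => ?_
  have sq : CommSq 0 S.f S'.g (S.g ≫ f) := ⟨by simp⟩
  refine ⟨hS.exact.desc sq.lift (by simp), ?_⟩
  rw [← cancel_epi S.g]
  simp

end Ext

/-! ### Completeness by the small object argument -/

section SmallObjectArgument

variable {D : Type u} [Category.{v} D] [Abelian D] [IsGrothendieckAbelian.{v} D]

open MorphismProperty in
lemma hasSmallObjectArgument_of_le_monomorphisms (I : MorphismProperty D)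
    [MorphismProperty.IsSmall.{v} I] (hI : I ≤ monomorphisms D) :
    HasSmallObjectArgument.{v} I := by
  -- A regular `κ` above the number of subobjects of every source makes these sources small with
  -- respect to `κ`-chains of monomorphisms.
  obtain ⟨κ, hκ', hκ⟩ := HasCardinalLT.exists_regular_cardinal.{v}
    (Σ x : I.toSet, Subobject x.1.left)
  have : Fact κ.IsRegular := ⟨hκ'⟩
  have : Nonempty κ.ord.ToType := by simpa using hκ'.ne_zero
  have := WellFoundedLT.toOrderBot κ.ord.ToType
  exact ⟨κ, inferInstance, inferInstance,
    { preservesColimit {A B X Y} i hi f hf := by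
        let hf' : (monomorphisms D).TransfiniteCompositionOfShape κ.ord.ToType f :=
          { toTransfiniteCompositionOfShape := hf.toTransfiniteCompositionOfShape
            map_mem j hj := by
              have := (hf.attachCells j hj).pushouts_coproducts
              simp only [ofHoms_homFamily] at this
              refine (?_ : _ ≤ monomorphisms D) _ this
              simp only [pushouts_le_iff, coproducts_le_iff]
              exact hI }
        have (j j' : κ.ord.ToType) (φ : j ⟶ j') : Mono (hf'.F.map φ) := hf'.mem_map φ
        apply IsGrothendieckAbelian.preservesColimit_coyoneda_obj_of_mono (Y := hf'.F) (κ := κ)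
        exact hκ.of_injective (fun y : Subobject A => 
            (⟨⟨Arrow.mk i, hi⟩, y⟩ : Σ x : I.toSet, Subobject x.1.left))
          fun _ _ h => eq_of_heq (Sigma.mk.inj h).2 }⟩

/-- A form of the theorem of Eklof and Trlifaj: if `S` is a set of objects, any morphism factors
as a monomorphism with cokernel in `⊥(S⊥)` followed by a morphism whose kernel is in `S⊥`. -/
lemma exists_factorization_of_small [EnoughProjectives D] (S : ObjectProperty D)
    [ObjectProperty.Small.{v} S] {A Z : D} (f : A ⟶ Z) :
    ∃ (X : D) (i : A ⟶ X) (p : X ⟶ Z), i ≫ p = f ∧ Mono i ∧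
      leftPerp (rightPerp S) (cokernel i) ∧
      ∀ (Y : D) (j : Y ⟶ X) (w : j ≫ p = 0), Mono j → (ShortComplex.mk j p w).Exact →
        rightPerp S Y := by
  let T (X : D) : ShortComplex D := .mk (kernel.ι (Projective.π X)) (Projective.π X) (by simp)
  have hT (X : D) : (T X).ShortExact := { exact := ShortComplex.exact_kernel _ }
  have (X : D) : Projective (T X).X₂ := inferInstanceAs (Projective (Projective.over X))
  let I := MorphismProperty.ofHoms fun X : Subtype S => (T X).f
  have : Small.{v} (Subtype S) := inferInstanceAs (ObjectProperty.Small.{v} S)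
  have hI : I ≤ MorphismProperty.monomorphisms D := by
    rintro _ _ _ ⟨X⟩
    exact (hT X).mono_f
  have := hasSmallObjectArgument_of_le_monomorphisms I hI
  let fac := MorphismProperty.factorizationData I.rlp.llp I.rlp f
  have hmono : Mono fac.i := by
    -- Maps from an injective object to `0` lift against all monomorphisms, hence against `I` and so
    -- against `fac.i`. Thus `A ⟶ Injective.under A` extends along `fac.i`.
    have : HasLiftingProperty fac.i (0 : Injective.under A ⟶ 0) := by
      refine fac.hi _ ?_
      intro K P g hg
      have : Mono g := hI _ hg
      exact ⟨fun {a b} sq => ⟨⟨⟨Injective.factorThru a g, by simp, (isZero_zero D).eq_of_tgt _ _⟩⟩⟩⟩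
    have sq : CommSq (Injective.ι A) fac.i (0 : Injective.under A ⟶ 0) 0 := ⟨by simp⟩
    exact mono_of_mono_fac sq.fac_left
  refine ⟨fac.Z, fac.i, fac.p, fac.fac, hmono, ?_, ?_⟩
  · refine leftPerp_of_forall_hasLiftingProperty
      (S := .mk fac.i (cokernel.π fac.i) (by simp)) { exact := ShortComplex.exact_cokernel _ } ?_
    intro S' hS' hY
    refine fac.hi _ ?_
    rintro _ _ _ ⟨X⟩
    have := hY X.1 X.2
    exact hasLiftingProperty_of_subsingleton_ext (hT X) hS'
  · intro Y j w _ hS' X hX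
    have : HasLiftingProperty (T X).f fac.p := fac.hp _ ⟨(⟨X, hX⟩ : Subtype S)⟩
    exact subsingleton_ext_of_hasLiftingProperty (S' := .mk j fac.p w) (hT X) hS'

lemma enoughProjectives_of_isSeparator {G : D} [Projective G] (hG : IsSeparator G) :
    EnoughProjectives D where
  presentation X := ⟨{
    p := ∐ fun _ : G ⟶ X => G
    f := Sigma.desc fun g => g
    epi := (isSeparator_iff_epi G).1 hG X }⟩

theorem isComplete_of_isCogeneratedBySet {B C : ObjectProperty D} {G : D} [Projective G]
    (hG : IsSeparator G) (h : IsCogeneratedBySet B C) : IsComplete B C := by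
  obtain ⟨S, hS, rfl, rfl⟩ := h
  have := enoughProjectives_of_isSeparator hG
  intro A
  constructor
  · obtain ⟨X, i, p, hp, hi, h₁, h₂⟩ := exists_factorization_of_small S (0 : A ⟶ 0)
    refine ⟨X, cokernel i, i, cokernel.π i, by simp, ?_, h₁,
      { exact := ShortComplex.exact_cokernel _ }⟩
    have hp0 : p = 0 := (isZero_zero D).eq_of_tgt _ _
    refine h₂ X (𝟙 X) (by simp [hp0]) inferInstance ?_
    rw [ShortComplex.exact_iff_epi _ hp0]
    dsimp
    infer_instance
  · obtain ⟨X, i, p, hp, hi, h₁, h₂⟩ := exists_factorization_of_small S (Projective.π A)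
    have : Epi p := epi_of_epi_fac hp
    refine ⟨kernel p, X, kernel.ι p, p, by simp, ?_, ?_, { exact := ShortComplex.exact_kernel _ }⟩
    · exact h₂ _ (kernel.ι p) (by simp) inferInstance (ShortComplex.exact_kernel _)
    · exact leftPerp_of_shortExact (S := .mk i (cokernel.π i) (by simp))
        { exact := ShortComplex.exact_cokernel _ } (leftPerp_of_projective _ _) h₁

end SmallObjectArgument

/-! ### Transfinite iteration and weakly terminal objects -/

section Iteration

universe u'

/-- The existence of colimits of (small, nonempty) directed systems. -/
def HasDirectedColimits (T : Type u') [Category.{v} T] : Prop :=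
  ∀ (J : Type v) [PartialOrder J] [IsDirectedOrder J] [Nonempty J], HasColimitsOfShape J T

lemma HasDirectedColimits.under {T : Type u'} [Category.{v} T] (hT : HasDirectedColimits T)
    (W : T) : HasDirectedColimits (Under W) := fun J _ _ _ => by
  have := IsFiltered.isConnected J
  have := hT J
  infer_instance

lemma HasDirectedColimits.hasIterationOfShape {T : Type u'} [Category.{v} T]
    (hT : HasDirectedColimits T) (J : Type v) [LinearOrder J] [Nonempty J] :
    HasIterationOfShape J T where
  hasColimitsOfShape_of_isSuccLimit j hj := by
    have := hj.nonempty_Iio.to_subtype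
    exact hT _
  hasColimitsOfShape := hT J

lemma exists_wellOrder_forall_not_injective (α : Type*) [Small.{v} α] :
    ∃ (J : Type v) (_ : LinearOrder J) (_ : OrderBot J) (_ : SuccOrder J) (_ : WellFoundedLT J)
      (_ : NoMaxOrder J), ∀ f : J → α, ¬ Function.Injective f := by
  obtain ⟨κ, hκ', hκ⟩ := HasCardinalLT.exists_regular_cardinal.{v} α
  have : Nonempty κ.ord.ToType := by simpa using hκ'.ne_zero
  have := Cardinal.noMaxOrder hκ'.aleph0_le
  refine ⟨κ.ord.ToType, inferInstance, WellFoundedLT.toOrderBot _, inferInstance, inferInstance,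
    inferInstance, fun f hf => ?_⟩
  simpa [hasCardinalLT_iff_cardinal_mk_lt] using hκ.of_injective f hf

variable {T : Type u'} [Category.{v} T]

/-- A monotone invariant of the objects of a category with directed colimits, with values in a
small partial order, is constant on all objects under a suitable object. -/
lemma HasDirectedColimits.exists_forall_eq [Nonempty T] (hT : HasDirectedColimits T)
    {α : Type*} [PartialOrder α] [Small.{v} α] (k : T → α)
    (hk : ∀ ⦃X Y : T⦄, (X ⟶ Y) → k X ≤ k Y) :
    ∃ Y : T, ∀ Z : T, (Y ⟶ Z) → k Z = k Y := by
  by_contra! H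
  choose s t hs using H
  obtain ⟨J, _, _, _, _, _, hJ⟩ := exists_wellOrder_forall_not_injective.{v} α
  have := hT.hasIterationOfShape J
  let Φ : SmallObject.SuccStruct T :=
    { X₀ := Classical.arbitrary T
      succ := s
      toSucc := t }
  let F := Φ.iterationFunctor J
  have hF : StrictMono fun j => k (F.obj j) := fun i j hij =>
    calc k (F.obj i) < k (s (F.obj i)) := lt_of_le_of_ne (hk (t _)) (hs _).symm
      _ ≤ k (F.obj (Order.succ i)) := hk (Φ.iterationFunctorObjSuccIso i (not_isMax i)).inv
      _ ≤ k (F.obj j) := hk (F.map (homOfLE (Order.succ_le_of_lt hij)))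
  exact hJ _ hF.injective

/-- Filtered colimits are exact, so `ker h` is the colimit of the kernels of `F.obj j ⟶ Y`, and
these die in `c.pt`. -/
lemma mono_of_isColimit {D : Type u} [Category.{v} D] [Abelian D] [IsGrothendieckAbelian.{v} D]
    {J : Type v} [SmallCategory J] [IsFiltered J] {F : J ⥤ D} {c : Cocone F} (hc : IsColimit c)
    {Y : D} (h : c.pt ⟶ Y)
    (H : ∀ (j : J) (Z : D) (z : Z ⟶ F.obj j), z ≫ c.ι.app j ≫ h = 0 → z ≫ c.ι.app j = 0) :
    Mono h := by
  have := IsFiltered.isConnected J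
  let φ : F ⟶ (Functor.const J).obj Y := { app j := c.ι.app j ≫ h }
  let S : ShortComplex (J ⥤ D) := .mk (kernel.ι φ) φ (by simp)
  have hS : S.Exact := ShortComplex.exact_kernel φ
  have := colim.exact_mapShortComplex hS (colimit.isColimit S.X₁) hc (isColimitConstCocone J Y) 0 h
    (fun j => by
      rw [comp_zero]
      refine (H j _ _ ?_).symm
      exact congr_app (kernel.condition φ) j) (fun j => by simp [S, φ, constCocone])
  exact (ShortComplex.exact_iff_mono _ rfl).1 this

variable {D : Type u} [Category.{v} D] [Abelian D] [IsGrothendieckAbelian.{v} D] (U : T ⥤ D)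
  {W : T}

include U in
/-- In a category with a weakly terminal object, there is a weakly terminal object such that all
morphisms from it become monomorphisms in `D`. -/
lemma HasDirectedColimits.exists_forall_mono (hT : HasDirectedColimits T)
    [PreservesColimitsOfShape (ULift.{v} ℕ) U] (hW : ∀ X : T, Nonempty (X ⟶ W)) :
    ∃ W' : T, (∀ X : T, Nonempty (X ⟶ W')) ∧ ∀ (X : T) (h : W' ⟶ X), Mono (U.map h) := by
  have : Nonempty (Under W) := ⟨Under.mk (𝟙 W)⟩
  obtain ⟨Y, hY⟩ := (hT.under W).exists_forall_eq
    (k := fun X : Under W => kernelSubobject (U.map X.hom)) fun X Y f => by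
      rw [← Under.w f, U.map_comp]
      exact kernelSubobject_comp_le _ _
  -- Both `f` and `f ≫ g` factor through `Y`, past which kernels no longer grow. The colimit of `W ⟶
  -- W ⟶ ⋯` along `f` therefore acquires no further kernel.
  let f : W ⟶ W := Y.hom ≫ (hW Y.right).some
  have hf {X : T} (g : W ⟶ X) {Z : D} (z : Z ⟶ U.obj W) (hz : z ≫ U.map (f ≫ g) = 0) :
      z ≫ U.map f = 0 := by
    have h₁ := hY (Under.mk (f ≫ g)) (Under.homMk ((hW Y.right).some ≫ g) (by simp [f]))
    have h₂ := hY (Under.mk f) (Under.homMk (hW Y.right).some (by simp [f]))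
    rw [← kernelSubobject_factors_iff] at hz ⊢
    exact (h₁.trans h₂.symm) ▸ hz
  have : IsDirectedOrder (ULift.{v} ℕ) := inferInstance
  have := hT (ULift.{v} ℕ)
  let G : ULift.{v} ℕ ⥤ T :=
    Monotone.functor (f := ULift.down) (fun _ _ h => h) ⋙ Functor.ofSequence (fun _ => f)
  refine ⟨colimit G, fun X => ⟨(hW X).some ≫ colimit.ι G ⟨0⟩⟩, fun X h => ?_⟩
  refine mono_of_isColimit (isColimitOfPreserves U (colimit.isColimit G)) (U.map h) ?_
  rintro ⟨n⟩ Z z hz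
  let ι (n : ℕ) : W ⟶ colimit G := colimit.ι G ⟨n⟩
  have hn : ι n = f ≫ ι (n + 1) := by
    refine (colimit.w G (homOfLE (Nat.le_succ n) : (⟨n⟩ : ULift.{v} ℕ) ⟶ ⟨n + 1⟩)).symm.trans ?_
    exact congrArg (· ≫ ι (n + 1)) (Functor.ofSequence_map_homOfLE_succ (fun _ => f) n)
  have key (z : Z ⟶ U.obj W) (hz : z ≫ U.map (ι n) ≫ U.map h = 0) : z ≫ U.map (ι n) = 0 := by
    rw [hn] at hz ⊢
    rw [U.map_comp, reassoc_of% (hf (ι (n + 1) ≫ h) z (by simpa using hz)), zero_comp]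
  exact key z hz

include U in
/-- A weakly terminal object such that all morphisms from it become monomorphisms in `D` has only
invertible endomorphisms. -/
lemma HasDirectedColimits.isIso_of_forall_mono (hT : HasDirectedColimits T)
    [U.ReflectsIsomorphisms] (hW : ∀ X : T, Nonempty (X ⟶ W))
    (hW' : ∀ (X : T) (h : W ⟶ X), Mono (U.map h)) (f : W ⟶ W) : IsIso f := by
  by_contra hf
  obtain ⟨J, _, _, _, _, _, hJ⟩ :=
    exists_wellOrder_forall_not_injective.{v} (Subobject (U.obj W))
  have := hT J
  have := hT.hasIterationOfShape J
  let Φ : SmallObject.SuccStruct T :=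
    { X₀ := W
      succ _ := W
      -- At limit stages the object need not be `W`, so a weakly terminal map precedes `f`.
      toSucc X := (hW X).some ≫ f }
  let F := Φ.iterationFunctor J
  let e (j : J) : F.obj (Order.succ j) ≅ W := Φ.iterationFunctorObjSuccIso j (not_isMax j)
  have hF (j : J) : F.map (homOfLE (Order.le_succ j)) =
    ((hW (F.obj j)).some ≫ f) ≫ (e j).inv := Φ.iterationFunctor_map_succ j (not_isMax j)
  have hmono (j : J) {X : T} (g : F.obj (Order.succ j) ⟶ X) : Mono (U.map g) := by
    have := hW' _ ((e j).inv ≫ g)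
    have hg : g = (e j).hom ≫ (e j).inv ≫ g := by simp
    rw [hg, U.map_comp]
    infer_instance
  -- in `D`, a monomorphism which is followed by another one to an isomorphism is invertible
  have hiso {X Y Z : D} (a : X ⟶ Y) (b : Y ⟶ Z) [Mono b] (h : IsIso (a ≫ b)) : IsIso b := by
    have : Epi b := epi_of_epi a b
    exact isIso_of_mono_of_epi b
  let p (j : J) : F.obj j ⟶ W := colimit.ι F j ≫ (hW (colimit F)).some
  -- Only successor stages are copies of `W`, so only there are outgoing maps known to be monic.
  let k (j : J) : Subobject (U.obj W) :=
    have := hmono j (p (Order.succ j))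
    Subobject.mk (U.map (p (Order.succ j)))
  have hk : StrictMono k := fun i j hij => by
    have := hmono i (p (Order.succ i))
    have := hmono j (p (Order.succ j))
    refine Subobject.mk_lt_mk_of_comm
      (U.map (F.map (homOfLE (Order.succ_le_succ hij.le)))) ?_ fun h => hf ?_
    · simp only [p, ← U.map_comp, colimit.w_assoc]
    · have hcomp : F.map (homOfLE (Order.succ_le_succ hij.le)) =
          F.map (homOfLE (Order.le_succ (Order.succ i))) ≫
            F.map (homOfLE (Order.succ_le_succ (Order.succ_le_of_lt hij))) := by
        rw [← F.map_comp]; rfl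
      rw [hcomp, U.map_comp] at h
      have := hmono (Order.succ i) (F.map (homOfLE (Order.succ_le_succ (Order.succ_le_of_lt hij))))
      have := hiso _ _ h
      have h' := IsIso.of_isIso_comp_right (U.map (F.map (homOfLE (Order.le_succ (Order.succ i)))))
        (U.map (F.map (homOfLE (Order.succ_le_succ (Order.succ_le_of_lt hij)))))
      rw [hF, U.map_comp] at h'
      have h'' := IsIso.of_isIso_comp_right (U.map ((hW (F.obj (Order.succ i))).some ≫ f))
        (U.map (e (Order.succ i)).inv)
      rw [U.map_comp] at h''
      have := hW' _ f
      have := hiso _ _ h''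
      exact isIso_of_reflects_iso f U
  exact hJ k hk.injective

end Iteration

/-! ### Existence of envelopes -/

section Envelope

lemma leftPerp_of_retract {D : Type u} [Category.{v} D] [Abelian D] [HasExt.{v} D]
    {P : ObjectProperty D} {X Z : D} (r : Retract X Z) (h : leftPerp P Z) : leftPerp P X := by
  intro Y hY
  have := h Y hY
  refine subsingleton_of_forall_eq 0 fun e => ?_
  have : (Abelian.Ext.mk₀ r.i).comp ((Abelian.Ext.mk₀ r.r).comp e (zero_add 1))
      (zero_add 1) = e := by
    simp [← Abelian.Ext.comp_assoc_of_second_deg_zero]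
  rw [← this, Subsingleton.elim ((Abelian.Ext.mk₀ r.r).comp e (zero_add 1)) 0,
    Abelian.Ext.comp_zero]

variable {D : Type u} [Category.{v} D] [Abelian D]

/-- If `g` is a monomorphism, `coker f ⟶ coker (f ≫ g) ⟶ coker g` is a short exact sequence. -/
lemma shortExact_cokernel_comp {X Y Z : D} (f : X ⟶ Y) (g : Y ⟶ Z) [Mono g] :
    (ShortComplex.mk (cokernel.map f (f ≫ g) (𝟙 _) g (by simp))
      (cokernel.map (f ≫ g) g f (𝟙 _) (by simp)) (by ext; simp)).ShortExact where
  exact := (kernelCokernelCompSequence_exact f g).exact' 3 4 5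
  mono_f := ((kernelCokernelCompSequence_exact f g).exact' 2 3 4).mono_g
    ((isZero_kernel_of_mono g).eq_of_src _ _)
  epi_g := by dsimp; infer_instance

/-- The objects under `M` whose structural morphism is a monomorphism with cokernel in `B`. -/
def underMonoWithCokernel (B : ObjectProperty D) (M : D) : ObjectProperty (Under M) :=
  fun X => Mono X.hom ∧ B (cokernel X.hom)

variable [IsGrothendieckAbelian.{v} D]

/-- Take the colimit of the sequences `0 ⟶ M ⟶ X_j ⟶ coker ⟶ 0`: it is exact, and the constant
diagram has colimit `M` because `J` is connected. -/
lemma isClosedUnderColimitsOfShape_underMonoWithCokernel (B : ObjectProperty D)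
    [B.IsClosedUnderIsomorphisms] (M : D) (J : Type v) [SmallCategory J] [IsFiltered J]
    [B.IsClosedUnderColimitsOfShape J] :
    (underMonoWithCokernel B M).IsClosedUnderColimitsOfShape J where
  colimitsOfShape_le := by
    rintro X ⟨p⟩
    have := IsFiltered.isConnected J
    have hc := isColimitOfPreserves (Under.forget M) p.isColimit
    let φ : (Functor.const J).obj M ⟶ p.diag ⋙ Under.forget M := { app j := (p.diag.obj j).hom }
    have (j : J) : Mono (φ.app j) := (p.prop_diag_obj j).1
    have := NatTrans.mono_of_mono_app φ
    have hX : Mono X.hom := colim.map_mono' φ (isColimitConstCocone J M) hc X.hom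
      (fun j => (Category.id_comp X.hom).trans (Under.w (p.ι.app j)).symm)
    refine ⟨hX, ?_⟩
    let S : ShortComplex (J ⥤ D) := .mk φ (cokernel.π φ) (by simp)
    have hS : S.Exact := ShortComplex.exact_cokernel φ
    let π : X.right ⟶ colimit (cokernel φ) := hc.desc ⟨_, cokernel.π φ ≫ (colimit.cocone _).ι⟩
    have hπ (j : J) : ((Under.forget M).mapCocone p.cocone).ι.app j ≫ π =
        (cokernel.π φ).app j ≫ colimit.ι (cokernel φ) j := hc.fac _ j
    obtain ⟨w, hex⟩ : ∃ w : X.hom ≫ π = 0, (ShortComplex.mk X.hom π w).Exact :=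
      ⟨_, colim.exact_mapShortComplex hS (isColimitConstCocone J M) hc
        (colimit.isColimit (cokernel φ)) X.hom π
        (fun j => (Category.id_comp X.hom).trans (Under.w (p.ι.app j)).symm) hπ⟩
    have hπ' : Epi π := colim.map_epi' (cokernel.π φ) ((Under.forget M).mapCocone p.cocone)
      (colimit.isColimit (cokernel φ)) π hπ
    have : Epi (ShortComplex.mk X.hom π w).g := hπ'
    have e : cokernel X.hom ≅ colimit (cokernel φ) :=
      (cokernelIsCokernel X.hom).coconePointUniqueUpToIso hex.gIsCokernel
    refine B.prop_of_iso e.symm (B.prop_colimit _ fun j => ?_)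
    exact B.prop_of_iso (PreservesCokernel.iso ((evaluation J D).obj j) φ).symm
      (p.prop_diag_obj j).2

theorem exists_isEnvelope {B C : ObjectProperty D} (hBC : IsCotorsionPair B C)
    (hcomp : IsComplete B C) (hclosed : ClosedUnderDirectLimits B) (M : D) :
    ∃ (E : D) (j : M ⟶ E), IsEnvelope C j := by
  have : B.IsClosedUnderIsomorphisms := ⟨fun e h => by
    rw [hBC.left_eq] at h ⊢
    exact leftPerp_of_retract (Retract.ofIso e.symm) h⟩
  let Q := underMonoWithCokernel B M
  have hQ (J : Type v) [PartialOrder J] [IsDirectedOrder J] [Nonempty J] :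
      Q.IsClosedUnderColimitsOfShape J := by
    have := hclosed J
    exact isClosedUnderColimitsOfShape_underMonoWithCokernel B M J
  have hT : HasDirectedColimits Q.FullSubcategory := fun J _ _ _ => by
    have := hQ J
    have := IsFiltered.isConnected J
    infer_instance
  have extend {X Y : D} {i : M ⟶ X} (hi : Q (Under.mk i)) (hY : C Y) (f : M ⟶ Y) :
      ∃ g : X ⟶ Y, i ≫ g = f := by
    have : Mono i := hi.1
    rw [hBC.right_eq] at hY
    let S := ShortComplex.mk i (cokernel.π i) (by simp)
    have hS : S.ShortExact := { exact := ShortComplex.exact_cokernel _ }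
    have : Subsingleton (Abelian.Ext S.X₃ Y 1) := hY _ hi.2
    exact exists_extension_of_subsingleton_ext hS f
  have mem {M X Z : D} {i : M ⟶ X} {p : X ⟶ Z} (w : i ≫ p = 0)
      (h : (ShortComplex.mk i p w).ShortExact) (hZ : B Z) :
      underMonoWithCokernel B M (Under.mk i) :=
    have e : Z ≅ cokernel i :=
      h.gIsCokernel.coconePointUniqueUpToIso (colimit.isColimit (parallelPair i 0))
    ⟨h.mono_f, B.prop_of_iso e hZ⟩
  obtain ⟨⟨E₀, B₀, i₀, p₀, w₀, hE₀, hB₀, h₀⟩, -⟩ := hcomp M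
  let U : Q.FullSubcategory ⥤ D := Q.ι ⋙ Under.forget M
  let W₀ : Q.FullSubcategory := ⟨Under.mk i₀, mem w₀ h₀ hB₀⟩
  have hW₀ (X : Q.FullSubcategory) : Nonempty (X ⟶ W₀) := by
    obtain ⟨g, hg⟩ := extend (i := X.obj.hom) X.property hE₀ i₀
    exact ⟨ObjectProperty.homMk (Under.homMk g hg)⟩
  have : IsDirectedOrder (ULift.{v} ℕ) := inferInstance
  have := hQ (ULift.{v} ℕ)
  have := IsFiltered.isConnected (ULift.{v} ℕ)
  have : PreservesColimitsOfShape (ULift.{v} ℕ) U := by infer_instance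
  obtain ⟨W, hW, hW'⟩ := hT.exists_forall_mono U hW₀
  have hiso := hT.isIso_of_forall_mono U hW hW'
  have hiso' (f : W.obj.right ⟶ W.obj.right) (hf : W.obj.hom ≫ f = W.obj.hom) : IsIso f := by
    let g : W ⟶ W := ObjectProperty.homMk (Under.homMk f hf)
    have := hiso g
    exact inferInstanceAs (IsIso (U.map g))
  have : Mono W.obj.hom := W.property.1
  have hmem : C W.obj.right := by
    obtain ⟨⟨E₁, B₁, i₁, p₁, w₁, hE₁, hB₁, h₁⟩, -⟩ := hcomp W.obj.right
    have hcomp₁ : Q (Under.mk (W.obj.hom ≫ i₁)) := by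
      have : Mono i₁ := h₁.mono_f
      refine ⟨inferInstanceAs (Mono (W.obj.hom ≫ i₁)), ?_⟩
      have h := shortExact_cokernel_comp W.obj.hom i₁
      have hB₁' := (mem w₁ h₁ hB₁).2
      have hB := W.property.2
      rw [hBC.left_eq] at hB hB₁' ⊢
      exact leftPerp_of_shortExact h hB hB₁'
    -- Weak terminality gives a map back from `E₁`; the round trip fixes `M`, hence is invertible
    -- and splits `i₁`.
    obtain ⟨t⟩ := hW ⟨_, hcomp₁⟩
    let r : E₁ ⟶ W.obj.right := t.hom.right
    have hr : (W.obj.hom ≫ i₁) ≫ r = W.obj.hom := Under.w t.hom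
    have := hiso' (i₁ ≫ r) (by simpa using hr)
    rw [hBC.right_eq] at hE₁ ⊢
    exact rightPerp_of_retract
      { i := i₁
        r := r ≫ inv (i₁ ≫ r)
        retract := by rw [← Category.assoc, IsIso.hom_inv_id] } hE₁
  exact ⟨W.obj.right, W.obj.hom,
    { mem := hmem
      factors Y f hY := extend (i := W.obj.hom) W.property hY f
      minimal := hiso' }⟩

end Envelope

end CotorsionPairs

theorem theorem5p6 {D : Type u} [Category.{v} D] [Abelian D] [IsGrothendieckAbelian.{v} D]
    (B C : ObjectProperty D) (hBC : CotorsionPairs.IsCotorsionPair B C) :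
    ((∃ G : D, Projective G ∧ IsSeparator G) → CotorsionPairs.IsCogeneratedBySet B C →
      CotorsionPairs.IsComplete B C) ∧
    (CotorsionPairs.IsComplete B C → CotorsionPairs.ClosedUnderDirectLimits B →
      ∀ M : D, ∃ (E : D) (j : M ⟶ E), CotorsionPairs.IsEnvelope C j) := by
  exact ⟨fun ⟨_, _, hG⟩ h => CotorsionPairs.isComplete_of_isCogeneratedBySet hG h,
    fun h h' => CotorsionPairs.exists_isEnvelope hBC h h'⟩
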